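/- A quantum network on parties $A_1,\dots,A_n$ consists of finitely many independent sources. Each source is shared by a set of $m\ge 2$ distinct parties and gives one qubit to each of them; the emitted state is the EPR state $\frac{1}{\sqrt2}(|00\rangle+|11\rangle)$ if $m=2$ and the GHZ state $\frac{1}{\sqrt2}(|0\rangle^{\otimes m}+|1\rangle^{\otimes m})$ if $m\ge 3$. Several sources may be shared by the same parties. The local Hilbert space of a party is the tensor product of its qubits, and $\rho_{\mathcal N}$ is the total (pure) state of the network $\mathcal N$. The characteristic vector of $\mathcal N$ is $S_{\mathcal N}=(S(\rho_{A_1}),\dots,S(\rho_{A_n}))$, where $S(\rho)=-\operatorname{Tr}\rho\log_2\rho$ and $\rho_{A_i}$ is the reduced state of $A_i$. Two networks $\mathcal N,\mathcal N'$ on the same parties are local-unitary equivalent if there are unitary maps $U_i$ from the local space of $A_i$ in $\mathcal N$ onto its local space in $\mathcal N'$ with $(\bigotimes_i U_i)\,\rho_{\mathcal N}\,(\bigotimes_i U_i)^\dagger=\rho_{\mathcal N'}$. **Theorem S6.** Let $\mathcal N_A$ be a quantum network all of whose sources emit EPR states, and suppose that $\mathcal N_A$ contains a cyclic subnetwork,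 i.e. for some $k\ge 3$ there are $k$ distinct parties in cyclic order such that any two consecutive ones share an EPR state (for example a triangle, $k=3$, or a four-partite cycle, $k=4$). Then there is a quantum network $\mathcal N_B$ on the same parties, consisting of EPR states and at least one GHZ state, such that $S_{\mathcal N_B}=S_{\mathcal N_A}$ but $\mathcal N_A$ and $\mathcal N_B$ are not local-unitary equivalent. Hence the characteristic vector cannot classify all networks: it is not true that any two networks of EPR and GHZ states on the same parties with equal characteristic vectors are local-unitary equivalent. -/

import Mathlib

open scoped Matrix

noncomputable section

/-- A quantum network on the parties `0, …, n - 1` consisting of EPR states and GHZ states: finitely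
many independent sources, where source `e` distributes one qubit to each party in `parties e`.
A source shared by two parties emits an EPR state, a source shared by `m ≥ 3` parties emits an
`m`-partite GHZ state. Several sources may be shared by the same parties. -/
structure QNetwork (n : ℕ) where
  numSources : ℕ
  parties : Fin numSources → Finset (Fin n)
  two_le_card : ∀ e, 2 ≤ (parties e).card

namespace QNetwork

variable {n : ℕ}

/-- All sources of the network emit EPR states. -/
def IsEPR (N : QNetwork n) : Prop := ∀ e, (N.parties e).card = 2

/-- Some source of the network emits a GHZ state (on at least three parties). -/
def HasGHZ (N : QNetwork n) : Prop := ∃ e, 3 ≤ (N.parties e).card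

/-- The network contains a cyclic subnetwork with `k` parties: `k` distinct parties in cyclic order,
any two consecutive ones of which share an EPR state. -/
def ContainsCycle (N : QNetwork n) (k : ℕ) : Prop :=
  ∃ c : Fin k → Fin n, Function.Injective c ∧
    ∀ t, ∃ e, N.parties e = {c t, c (finRotate k t)}

/-- The computational basis of the local Hilbert space of party `i`, which consists of one qubit
for each source that the party is connected to. -/
abbrev LocalBasis (N : QNetwork n) (i : Fin n) : Type :=
  {e : Fin N.numSources // i ∈ N.parties e} → Fin 2

/-- The computational basis of the joint Hilbert space of all parties. -/
abbrev GlobalBasis (N : QNetwork n) : Type := ∀ i : Fin n, N.LocalBasis i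

/-- The amplitudes of `(|0…0⟩ + |1…1⟩) / √2` on qubits indexed by `s`. For two qubits this is the
EPR state, for three or more the GHZ state. -/
def ghzAmplitude {s : Type} (b : s → Fin 2) : ℂ :=
  open Classical in
  if b = (fun _ => 0) ∨ b = (fun _ => 1) then ((1 / Real.sqrt 2 : ℝ) : ℂ) else 0

/-- The total state vector of the network: the tensor product of the states of its sources. -/
def stateVector (N : QNetwork n) : N.GlobalBasis → ℂ := fun x =>
  ∏ e, ghzAmplitude (fun i : {i // i ∈ N.parties e} => x i.1 ⟨e, i.2⟩)

/-- The total density matrix `|ψ⟩⟨ψ|` of the network. -/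
def density (N : QNetwork n) : Matrix N.GlobalBasis N.GlobalBasis ℂ :=
  Matrix.vecMulVec N.stateVector (star N.stateVector)

/-- The reduced density matrix of party `i`: the partial trace over all the other parties. -/
def reduced (N : QNetwork n) (i : Fin n) : Matrix (N.LocalBasis i) (N.LocalBasis i) ℂ :=
  Matrix.of fun a b => ∑ z : ∀ j : {j // j ≠ i}, N.LocalBasis j.1,
    N.density ((Equiv.piSplitAt i N.LocalBasis).symm (a, z))
      ((Equiv.piSplitAt i N.LocalBasis).symm (b, z))

theorem density_isHermitian (N : QNetwork n) : N.density.IsHermitian :=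
  Matrix.IsHermitian.ext fun x y => by
    rw [density, Matrix.vecMulVec_apply, Matrix.vecMulVec_apply, star_mul', Pi.star_apply,
      Pi.star_apply, star_star, mul_comm]

theorem reduced_isHermitian (N : QNetwork n) (i : Fin n) : (N.reduced i).IsHermitian :=
  Matrix.IsHermitian.ext fun a b => by
    rw [reduced, Matrix.of_apply, Matrix.of_apply, star_sum]
    exact Finset.sum_congr rfl fun z _ => N.density_isHermitian.apply _ _

end QNetwork

/-- The von Neumann entropy `-Tr (ρ log₂ ρ)`, computed from the eigenvalues of `ρ`. -/
def vonNeumannEntropy {d : Type} [Fintype d] [DecidableEq d] {ρ : Matrix d d ℂ}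
    (hρ : ρ.IsHermitian) : ℝ :=
  -∑ k, hρ.eigenvalues k * Real.logb 2 (hρ.eigenvalues k)

namespace QNetwork

variable {n : ℕ}

/-- The characteristic vector: the von Neumann entropies of the reduced states of the parties. -/
def charVector (N : QNetwork n) : Fin n → ℝ := fun i =>
  vonNeumannEntropy (N.reduced_isHermitian i)

/-- The tensor product `⊗ᵢ Uᵢ` of local operators, as an operator on the joint space. -/
def tensorOp {N M : QNetwork n} (U : ∀ i, Matrix (M.LocalBasis i) (N.LocalBasis i) ℂ) :
    Matrix M.GlobalBasis N.GlobalBasis ℂ :=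
  Matrix.of fun y x => ∏ i, U i (y i) (x i)

/-- Local unitary equivalence: there are unitary maps `Uᵢ` from the local space of party `i` in `N`
onto the local space of party `i` in `M` with `(⊗ᵢ Uᵢ) ρ_N (⊗ᵢ Uᵢ)† = ρ_M`. -/
def LUEquivalent (N M : QNetwork n) : Prop :=
  ∃ U : ∀ i, Matrix (M.LocalBasis i) (N.LocalBasis i) ℂ,
    (∀ i, (U i)ᴴ * U i = 1 ∧ U i * (U i)ᴴ = 1) ∧
      tensorOp U * N.density * (tensorOp U)ᴴ = M.density

end QNetwork

end

noncomputable section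

/-! ### Tensor products of families of matrices -/

section PiKronecker

variable {ι : Type} [Fintype ι] {l m n : ι → Type}

/-- The tensor product of a finite family of matrices. -/
def piKronecker (A : ∀ i, Matrix (l i) (m i) ℂ) : Matrix (∀ i, l i) (∀ i, m i) ℂ :=
  Matrix.of fun x y => ∏ i, A i (x i) (y i)

theorem piKronecker_mul [DecidableEq ι] [∀ i, Fintype (m i)]
    (A : ∀ i, Matrix (l i) (m i) ℂ) (B : ∀ i, Matrix (m i) (n i) ℂ) :
    piKronecker A * piKronecker B = piKronecker fun i => A i * B i := by
  ext x y
  simp only [piKronecker, Matrix.mul_apply, Matrix.of_apply, Fintype.prod_sum,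
    Finset.prod_mul_distrib]

theorem piKronecker_one [∀ i, DecidableEq (m i)] [DecidableEq (∀ i, m i)] :
    (piKronecker fun i => (1 : Matrix (m i) (m i) ℂ)) = 1 := by
  ext x y
  simp only [piKronecker, Matrix.of_apply, Matrix.one_apply, Finset.prod_ite_zero,
    Finset.prod_const_one, Finset.mem_univ, true_imp_iff, funext_iff]

theorem piKronecker_conjTranspose (A : ∀ i, Matrix (l i) (m i) ℂ) :
    (piKronecker A)ᴴ = piKronecker fun i => (A i)ᴴ := by
  ext x y
  simp [piKronecker, Matrix.conjTranspose_apply]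

end PiKronecker

/-! ### Amplitudes of EPR and GHZ states -/

namespace QNetwork

section Amplitude

variable {s : Type}

theorem ghzAmplitude_const (v : Fin 2) :
    ghzAmplitude (fun _ : s => v) = ((1 / Real.sqrt 2 : ℝ) : ℂ) := by
  rw [ghzAmplitude, if_pos]
  fin_cases v
  · exact Or.inl rfl
  · exact Or.inr rfl

theorem exists_eq_const_of_ghzAmplitude_ne_zero {b : s → Fin 2} (h : ghzAmplitude b ≠ 0) :
    ∃ v, b = fun _ => v := by
  by_contra hb
  refine h (if_neg ?_)
  rintro (h0 | h1)
  · exact hb ⟨0, h0⟩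
  · exact hb ⟨1, h1⟩

theorem star_ghzAmplitude (b : s → Fin 2) : star (ghzAmplitude b) = ghzAmplitude b := by
  rw [ghzAmplitude]
  split_ifs
  · exact Complex.conj_ofReal _
  · exact star_zero _

theorem one_div_sqrt_two_mul_self :
    ((1 / Real.sqrt 2 : ℝ) : ℂ) * ((1 / Real.sqrt 2 : ℝ) : ℂ) = 1 / 2 := by
  rw [← Complex.ofReal_mul, div_mul_div_comm, Real.mul_self_sqrt zero_le_two]
  norm_num

variable [Fintype s] [DecidableEq s] [Nonempty s]

/-- A sum weighted by GHZ amplitudes, one for each index in `R`, is supported on constant bit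
strings. -/
theorem sum_prod_ghzAmplitude_mul {R : Type} [Fintype R] [DecidableEq R]
    (G : (R → s → Fin 2) → ℂ) :
    ∑ x : R → s → Fin 2, (∏ r, ghzAmplitude (x r)) * G x =
      ∑ b : R → Fin 2, ((1 / Real.sqrt 2 : ℝ) : ℂ) ^ Fintype.card R * G fun r _ => b r := by
  symm
  refine Fintype.sum_of_injective (fun b r _ => b r) ?_ _ _ ?_ ?_
  · intro b b' h
    funext r
    exact congrFun (congrFun h r) (Classical.arbitrary s)
  · intro x hx
    by_contra h
    have hne : ∀ r, ghzAmplitude (x r) ≠ 0 := fun r hr =>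
      h (by rw [Finset.prod_eq_zero (Finset.mem_univ r) hr, zero_mul])
    choose v hv using fun r => exists_eq_const_of_ghzAmplitude_ne_zero (hne r)
    exact hx ⟨v, (funext hv).symm⟩
  · intro b
    simp only [ghzAmplitude_const, Finset.prod_const, Finset.card_univ]

theorem sum_ghzAmplitude_mul (G : (s → Fin 2) → ℂ) :
    ∑ x : s → Fin 2, ghzAmplitude x * G x =
      ∑ v : Fin 2, ((1 / Real.sqrt 2 : ℝ) : ℂ) * G fun _ => v := by
  symm
  refine Fintype.sum_of_injective (fun v _ => v) ?_ _ _ ?_ ?_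
  · intro v v' h
    exact congrFun h (Classical.arbitrary s)
  · intro x hx
    by_contra h
    obtain ⟨v, hv⟩ := exists_eq_const_of_ghzAmplitude_ne_zero (left_ne_zero_of_mul h)
    exact hx ⟨v, hv.symm⟩
  · intro v
    rw [ghzAmplitude_const]

end Amplitude

variable {n : ℕ}

theorem nonempty_parties (N : QNetwork n) (e : Fin N.numSources) :
    Nonempty {i // i ∈ N.parties e} :=
  (Finset.card_pos.1 (zero_lt_two.trans_le (N.two_le_card e))).to_subtype

theorem star_stateVector (N : QNetwork n) (x : N.GlobalBasis) :
    star (N.stateVector x) = N.stateVector x := by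
  simp only [stateVector, star_prod, star_ghzAmplitude]

theorem density_apply (N : QNetwork n) (x y : N.GlobalBasis) :
    N.density x y = N.stateVector x * N.stateVector y := by
  rw [density, Matrix.vecMulVec_apply, Pi.star_apply, star_stateVector]

/-- Grouping the qubits by sources instead of by parties. -/
def globalBasisEquiv (N : QNetwork n) :
    N.GlobalBasis ≃ ∀ e, {i // i ∈ N.parties e} → Fin 2 where
  toFun x e i := x i.1 ⟨e, i.2⟩
  invFun y i e := y e.1 ⟨i, e.2⟩
  left_inv _ := rfl
  right_inv _ := rfl

/-- Grouping the qubits of several copies of the network by sources. -/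
def globalBasisCopiesEquiv (N : QNetwork n) (R : Type) :
    (R → N.GlobalBasis) ≃ ∀ e, R → {i // i ∈ N.parties e} → Fin 2 where
  toFun x e r i := x r i.1 ⟨e, i.2⟩
  invFun y r i e := y e.1 r ⟨i, e.2⟩
  left_inv _ := rfl
  right_inv _ := rfl

/-! ### The characteristic vector -/

/-- The number of sources that a party is connected to. -/
def degree (N : QNetwork n) (i : Fin n) : ℕ := ∑ e, if i ∈ N.parties e then 1 else 0

theorem card_localBasis (N : QNetwork n) (i : Fin n) :
    Fintype.card (N.LocalBasis i) = 2 ^ N.degree i := by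
  rw [Fintype.card_fun, Fintype.card_fin, Fintype.card_subtype, degree, Finset.card_filter]

theorem stateVector_mul_stateVector_eq_zero (N : QNetwork n) {i : Fin n} {x y : N.GlobalBasis}
    (hxy : ∀ j, j ≠ i → x j = y j) (hi : x i ≠ y i) :
    N.stateVector x * N.stateVector y = 0 := by
  by_contra h
  obtain ⟨⟨e, he⟩, hne⟩ := Function.ne_iff.1 hi
  obtain ⟨j, hj, hji⟩ := Finset.exists_mem_ne (N.two_le_card e) i
  have hx := Finset.prod_ne_zero_iff.1 (left_ne_zero_of_mul h) e (Finset.mem_univ e)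
  have hy := Finset.prod_ne_zero_iff.1 (right_ne_zero_of_mul h) e (Finset.mem_univ e)
  obtain ⟨v, hv⟩ := exists_eq_const_of_ghzAmplitude_ne_zero hx
  obtain ⟨w, hw⟩ := exists_eq_const_of_ghzAmplitude_ne_zero hy
  have hvi := congrFun hv ⟨i, he⟩
  have hvj := congrFun hv ⟨j, hj⟩
  have hwi := congrFun hw ⟨i, he⟩
  have hwj := congrFun hw ⟨j, hj⟩
  dsimp only at hvi hvj hwi hwj
  exact hne (by rw [hvi, hwi, ← hvj, ← hwj, hxy j hji])

theorem sum_stateVector_mul_self_of_local_eq (N : QNetwork n) (i : Fin n) (a : N.LocalBasis i) :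
    ∑ x : N.GlobalBasis, (if x i = a then N.stateVector x * N.stateVector x else 0) =
      (1 / 2 : ℂ) ^ N.degree i := by
  let f : ∀ e, ({j // j ∈ N.parties e} → Fin 2) → ℂ := fun e s =>
    if ∀ h : i ∈ N.parties e, s ⟨i, h⟩ = a ⟨e, h⟩ then ghzAmplitude s else 0
  have h1 : ∀ x : N.GlobalBasis, (if x i = a then N.stateVector x * N.stateVector x else 0) =
      ∏ e, ghzAmplitude (N.globalBasisEquiv x e) * f e (N.globalBasisEquiv x e) := by
    intro x
    rw [Finset.prod_mul_distrib]
    simp only [f, Finset.prod_ite_zero]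
    have : (x i = a) ↔ ∀ e ∈ Finset.univ, ∀ h : i ∈ N.parties e,
        N.globalBasisEquiv x e ⟨i, h⟩ = a ⟨e, h⟩ := by
      rw [funext_iff, Subtype.forall]
      simp [globalBasisEquiv]
    rw [mul_ite, mul_zero]
    by_cases hx : x i = a
    · rw [if_pos hx, if_pos (this.1 hx)]
      rfl
    · rw [if_neg hx, if_neg (mt this.2 hx)]
  rw [Finset.sum_congr rfl fun x _ => h1 x,
    N.globalBasisEquiv.sum_comp fun y => ∏ e, ghzAmplitude (y e) * f e (y e),
    ← Fintype.prod_sum fun e s => ghzAmplitude s * f e s, degree, ← Finset.prod_pow_eq_pow_sum]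
  refine Finset.prod_congr rfl fun e _ => ?_
  have := N.nonempty_parties e
  rw [sum_ghzAmplitude_mul]
  simp only [f, ghzAmplitude_const, mul_ite, mul_zero, one_div_sqrt_two_mul_self]
  by_cases h : i ∈ N.parties e
  · simp [h]
  · simp [h]

theorem reduced_eq_smul_one (N : QNetwork n) (i : Fin n) :
    N.reduced i = (((1 / 2 : ℝ) ^ N.degree i : ℝ) : ℂ) • 1 := by
  ext a b
  rw [reduced, Matrix.of_apply, Matrix.smul_apply, Matrix.one_apply]
  simp only [density_apply]
  split_ifs with hab
  · subst hab
    rw [smul_eq_mul, mul_one, Complex.ofReal_pow, Complex.ofReal_div, Complex.ofReal_one,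
      Complex.ofReal_ofNat, ← N.sum_stateVector_mul_self_of_local_eq i a,
      ← (Equiv.piSplitAt i N.LocalBasis).symm.sum_comp, Fintype.sum_prod_type]
    rw [Finset.sum_eq_single a]
    · refine Finset.sum_congr rfl fun z _ => ?_
      rw [if_pos]
      simp
    · intro b _ hb
      refine Finset.sum_eq_zero fun z _ => if_neg ?_
      simpa using hb
    · exact fun h => absurd (Finset.mem_univ a) h
  · rw [smul_zero]
    refine Finset.sum_eq_zero fun z _ => N.stateVector_mul_stateVector_eq_zero (i := i) ?_ ?_
    · intro j hj
      simp [hj]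
    · simpa using hab

end QNetwork

theorem Matrix.IsHermitian.eigenvalues_eq_of_eq_smul_one {d : Type} [Fintype d] [DecidableEq d]
    {ρ : Matrix d d ℂ} (hρ : ρ.IsHermitian) {c : ℝ} (h : ρ = (c : ℂ) • 1) (k : d) :
    hρ.eigenvalues k = c := by
  have hmul : ∀ v : d → ℂ, ρ *ᵥ v = (c : ℂ) • v := fun v => by
    rw [h, Matrix.smul_mulVec, Matrix.one_mulVec]
  rw [hρ.eigenvalues_eq, hmul, dotProduct_smul, dotProduct_comm, ← EuclideanSpace.inner_eq_star_dotProduct, inner_self_eq_norm_sq_to_K,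
    OrthonormalBasis.norm_eq_one]
  simp

theorem vonNeumannEntropy_of_eq_smul_one {d : Type} [Fintype d] [DecidableEq d]
    {ρ : Matrix d d ℂ} (hρ : ρ.IsHermitian) {c : ℝ} (h : ρ = (c : ℂ) • 1) :
    vonNeumannEntropy hρ = -(Fintype.card d * (c * Real.logb 2 c)) := by
  simp only [vonNeumannEntropy, hρ.eigenvalues_eq_of_eq_smul_one h, Finset.sum_const,
    Finset.card_univ, nsmul_eq_mul]

namespace QNetwork

variable {n : ℕ}

/-- The entropy of the reduced state of a party is the number of its qubits. -/
theorem charVector_eq_degree (N : QNetwork n) (i : Fin n) : N.charVector i = N.degree i := by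
  rw [charVector, vonNeumannEntropy_of_eq_smul_one _ (N.reduced_eq_smul_one i), card_localBasis,
    Real.logb_pow, one_div, Real.logb_inv, Real.logb_self_eq_one one_lt_two, Nat.cast_pow,
    Nat.cast_ofNat, ← mul_assoc, ← mul_pow, mul_inv_cancel₀ two_ne_zero]
  simp

/-! ### A local-unitary invariant -/

/-- The permutation of the basis of three copies of the network which rotates the copies of
party `i` by `col i`. -/
def rotateCopies (N : QNetwork n) (col : Fin n → ZMod 3) :
    (ZMod 3 → N.GlobalBasis) ≃ (ZMod 3 → N.GlobalBasis) where
  toFun x r i := x (r + col i) i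
  invFun x r i := x (r - col i) i
  left_inv x := by funext r i; simp
  right_inv x := by funext r i; simp

/-- The expectation of the permutation `rotateCopies` in three copies of the network state. -/
def rotationInvariant (N : QNetwork n) (col : Fin n → ZMod 3) : ℂ :=
  ∑ x : ZMod 3 → N.GlobalBasis, ∏ r, N.density (x r) (N.rotateCopies col x r)

theorem rotationInvariant_eq_trace (N : QNetwork n) (col : Fin n → ZMod 3) :
    N.rotationInvariant col =
      ((piKronecker fun _ : ZMod 3 => N.density).submatrix id (N.rotateCopies col)).trace := rfl

theorem tensorOp_conjTranspose_mul_self {N M : QNetwork n}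
    {U : ∀ i, Matrix (M.LocalBasis i) (N.LocalBasis i) ℂ} (hU : ∀ i, (U i)ᴴ * U i = 1) :
    (tensorOp U)ᴴ * tensorOp U = 1 := by
  change (piKronecker U)ᴴ * piKronecker U = 1
  rw [piKronecker_conjTranspose, piKronecker_mul]
  simp only [hU]
  exact piKronecker_one

theorem piKronecker_tensorOp_rotateCopies {N M : QNetwork n} (col : Fin n → ZMod 3)
    (U : ∀ i, Matrix (M.LocalBasis i) (N.LocalBasis i) ℂ) (x : ZMod 3 → M.GlobalBasis)
    (y : ZMod 3 → N.GlobalBasis) :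
    piKronecker (fun _ => tensorOp U) (M.rotateCopies col x) (N.rotateCopies col y) =
      piKronecker (fun _ => tensorOp U) x y := by
  simp only [piKronecker, tensorOp, Matrix.of_apply, rotateCopies, Equiv.coe_fn_mk]
  rw [Finset.prod_comm, Finset.prod_comm (s := (Finset.univ : Finset (ZMod 3)))]
  exact Finset.prod_congr rfl fun i _ =>
    Equiv.prod_comp (Equiv.addRight (col i)) fun r => U i (x r i) (y r i)

theorem LUEquivalent.rotationInvariant_eq {N M : QNetwork n} (h : LUEquivalent N M)
    (col : Fin n → ZMod 3) : N.rotationInvariant col = M.rotationInvariant col := by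
  obtain ⟨U, hU, hUM⟩ := h
  set V := piKronecker fun _ : ZMod 3 => tensorOp U with hV
  have hVV : Vᴴ * V = 1 := by
    rw [hV, piKronecker_conjTranspose, piKronecker_mul]
    simp only [tensorOp_conjTranspose_mul_self fun i => (hU i).1]
    exact piKronecker_one
  have hM : (piKronecker fun _ : ZMod 3 => M.density) =
      V * (piKronecker fun _ : ZMod 3 => N.density) * Vᴴ := by
    rw [hV, piKronecker_conjTranspose, piKronecker_mul, piKronecker_mul, hUM]
  have hrot : Vᴴ.submatrix id (M.rotateCopies col) =
      Vᴴ.submatrix (N.rotateCopies col).symm id := by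
    ext y x
    have := piKronecker_tensorOp_rotateCopies col U x ((N.rotateCopies col).symm y)
    rw [Equiv.apply_symm_apply] at this
    exact congrArg star this
  have hK : ∀ K : Matrix (ZMod 3 → N.GlobalBasis) (ZMod 3 → N.GlobalBasis) ℂ,
      K * Vᴴ.submatrix (N.rotateCopies col).symm id =
        K.submatrix id (N.rotateCopies col) * Vᴴ := by
    intro K
    have := Matrix.submatrix_mul_equiv K (Vᴴ.submatrix (N.rotateCopies col).symm id) id
      (N.rotateCopies col) id
    rw [Matrix.submatrix_id_id] at this
    rw [← this]
    congr 1
    ext y x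
    simp
  rw [rotationInvariant_eq_trace, rotationInvariant_eq_trace, hM,
    Matrix.submatrix_mul _ _ id id _ Function.bijective_id, Matrix.submatrix_id_id, hrot,
    Matrix.mul_assoc, hK, Matrix.trace_mul_comm, Matrix.mul_assoc, hVV, Matrix.mul_one]

/-- The contribution of a source with parties `p` to the rotation invariant. -/
def rotationWeight (col : Fin n → ZMod 3) (p : Finset (Fin n)) : ℝ :=
  open Classical in if ∃ i ∈ p, ∃ j ∈ p, col i ≠ col j then 1 / 4 else 1

theorem rotationWeight_pos (col : Fin n → ZMod 3) (p : Finset (Fin n)) :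
    0 < rotationWeight col p := by
  rw [rotationWeight]
  split_ifs <;> norm_num

theorem rotationWeight_le_one (col : Fin n → ZMod 3) (p : Finset (Fin n)) :
    rotationWeight col p ≤ 1 := by
  rw [rotationWeight]
  split_ifs <;> norm_num

theorem rotationWeight_of_ne {col : Fin n → ZMod 3} {p : Finset (Fin n)} {i j : Fin n}
    (hi : i ∈ p) (hj : j ∈ p) (h : col i ≠ col j) : rotationWeight col p = 1 / 4 :=
  if_pos ⟨i, hi, j, hj, h⟩

theorem eq_const_of_shift_eq {b : ZMod 3 → Fin 2} {u v : ZMod 3} (huv : u ≠ v)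
    (h : ∀ r, b (r + u) = b (r + v)) : ∃ w, b = fun _ => w := by
  revert b u v
  decide

theorem sum_source_rotate (col : Fin n → ZMod 3) {p : Finset (Fin n)} (hp : p.Nonempty) :
    ∑ s : ZMod 3 → {i // i ∈ p} → Fin 2,
      (∏ r, ghzAmplitude (s r)) * ∏ r, ghzAmplitude (fun i => s (r + col i.1) i) =
      (rotationWeight col p : ℂ) := by
  have : Nonempty {i // i ∈ p} := hp.to_subtype
  rw [sum_prod_ghzAmplitude_mul fun s : ZMod 3 → {i // i ∈ p} → Fin 2 =>
      ∏ r, ghzAmplitude fun i => s (r + col i.1) i,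
    rotationWeight, ZMod.card]
  have hpow : ((1 / Real.sqrt 2 : ℝ) : ℂ) ^ 3 * ((1 / Real.sqrt 2 : ℝ) : ℂ) ^ 3 = 1 / 8 := by
    rw [← mul_pow, one_div_sqrt_two_mul_self]
    norm_num
  split_ifs with h
  · obtain ⟨i, hi, j, hj, hij⟩ := h
    trans ∑ v : Fin 2, (1 / 8 : ℂ)
    · symm
      refine Fintype.sum_of_injective (fun v _ => v) ?_ _ _ ?_ ?_
      · intro v v' h
        exact congrFun h 0
      · intro b hb
        by_contra h
        have hne := Finset.prod_ne_zero_iff.1 (right_ne_zero_of_mul h)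
        obtain ⟨w, hw⟩ := eq_const_of_shift_eq hij (b := b) fun r => by
          obtain ⟨v, hv⟩ := exists_eq_const_of_ghzAmplitude_ne_zero (hne r (Finset.mem_univ r))
          exact (congrFun hv ⟨i, hi⟩).trans (congrFun hv ⟨j, hj⟩).symm
        exact hb ⟨w, hw.symm⟩
      · intro v
        simp only [ghzAmplitude_const, Finset.prod_const, Finset.card_univ, ZMod.card, hpow]
    · norm_num
  · push Not at h
    obtain ⟨i, hi⟩ := hp
    have hconst : ∀ (b : ZMod 3 → Fin 2) (r : ZMod 3),
        (fun j : {i // i ∈ p} => b (r + col j.1)) = fun _ => b (r + col i) := by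
      intro b r
      funext j
      rw [h j.1 j.2 i hi]
    simp only [hconst, ghzAmplitude_const, Finset.prod_const, Finset.card_univ, ZMod.card, hpow,
      Finset.sum_const, Fintype.card_fun, Fintype.card_fin]
    norm_num

theorem rotationInvariant_eq_prod (N : QNetwork n) (col : Fin n → ZMod 3) :
    N.rotationInvariant col = ((∏ e, rotationWeight col (N.parties e) : ℝ) : ℂ) := by
  let f : ∀ e, (ZMod 3 → {i // i ∈ N.parties e} → Fin 2) → ℂ := fun e s =>
    (∏ r, ghzAmplitude (s r)) * ∏ r, ghzAmplitude (fun i => s (r + col i.1) i)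
  have h1 : ∀ x : ZMod 3 → N.GlobalBasis, ∏ r, N.density (x r) (N.rotateCopies col x r) =
      ∏ e, f e (N.globalBasisCopiesEquiv (ZMod 3) x e) := by
    intro x
    simp only [density_apply, f, Finset.prod_mul_distrib, stateVector]
    rw [Finset.prod_comm, Finset.prod_comm (s := (Finset.univ : Finset (ZMod 3)))]
    rfl
  rw [rotationInvariant, Finset.sum_congr rfl fun x _ => h1 x,
    (N.globalBasisCopiesEquiv (ZMod 3)).sum_comp fun y => ∏ e, f e (y e), ← Fintype.prod_sum f,
    Complex.ofReal_prod]
  exact Finset.prod_congr rfl fun e _ => sum_source_rotate col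
    (Finset.card_pos.1 (zero_lt_two.trans_le (N.two_le_card e)))

/-! ### Replacing a cycle of EPR states by two GHZ states -/

/-- The network with sources indexed by an arbitrary finite type. -/
def ofFintype {ι : Type} [Fintype ι] (p : ι → Finset (Fin n)) (hp : ∀ e, 2 ≤ (p e).card) :
    QNetwork n where
  numSources := Fintype.card ι
  parties e := p ((Fintype.equivFin ι).symm e)
  two_le_card _ := hp _

/-- The network obtained by deleting the sources in `E` and adding two sources with parties `C`. -/
def replace (N : QNetwork n) (E : Finset (Fin N.numSources)) (C : Finset (Fin n))
    (hC : 2 ≤ C.card) : QNetwork n :=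
  ofFintype (ι := {e // e ∉ E} ⊕ Fin 2) (Sum.elim (fun e => N.parties e.1) fun _ => C)
    (Sum.rec (fun e => N.two_le_card e.1) fun _ => hC)

@[to_additive]
theorem prod_replace {α : Type*} [CommMonoid α] (N : QNetwork n) (E : Finset (Fin N.numSources))
    (C : Finset (Fin n)) (hC : 2 ≤ C.card) (f : Finset (Fin n) → α) :
    ∏ e, f ((N.replace E C hC).parties e) = (∏ e ∈ Eᶜ, f (N.parties e)) * (f C * f C) := by
  have h := (Fintype.equivFin ({e // e ∉ E} ⊕ Fin 2)).symm.prod_comp fun e =>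
    f (Sum.elim (fun e => N.parties e.1) (fun _ => C) e)
  refine h.trans ?_
  rw [Fintype.prod_sum_type, Fin.prod_univ_two]
  congr 1
  exact (Finset.prod_subtype Eᶜ (fun _ => Finset.mem_compl) fun e => f (N.parties e)).symm

theorem hasGHZ_replace (N : QNetwork n) (E : Finset (Fin N.numSources)) (C : Finset (Fin n))
    (hC : 3 ≤ C.card) : (N.replace E C (Nat.le_of_succ_le hC)).HasGHZ := by
  refine ⟨Fintype.equivFin ({e // e ∉ E} ⊕ Fin 2) (Sum.inr 0), ?_⟩
  simp [replace, ofFintype, hC]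

theorem cycle_edge_injective {m : ℕ} {c : Fin (m + 3) → Fin n} (hc : Function.Injective c)
    {t u : Fin (m + 3)} (h : ({c t, c (t + 1)} : Finset (Fin n)) = {c u, c (u + 1)}) : t = u := by
  have ht : c t ∈ ({c u, c (u + 1)} : Finset (Fin n)) := h ▸ Finset.mem_insert_self _ _
  have hu : c u ∈ ({c t, c (t + 1)} : Finset (Fin n)) := h ▸ Finset.mem_insert_self _ _
  simp only [Finset.mem_insert, Finset.mem_singleton, hc.eq_iff] at ht hu
  rcases ht with ht | ht
  · exact ht
  rcases hu with hu | hu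
  · exact hu.symm
  exfalso
  have h2 : (1 : Fin (m + 3)) + 1 = 0 := by
    rw [ht, add_assoc] at hu
    exact left_eq_add.1 hu
  have h3 := congrArg Fin.val h2
  rw [Fin.val_add, Fin.val_one, Fin.val_zero, Nat.mod_eq_of_lt (by omega)] at h3
  omega

/-- Every party of a cycle is in exactly two of its edges. -/
theorem sum_cycle_edge_mem {m : ℕ} {c : Fin (m + 3) → Fin n} (hc : Function.Injective c)
    (i : Fin n) :
    (∑ t, if i ∈ ({c t, c (t + 1)} : Finset (Fin n)) then 1 else 0) =
      (if i ∈ Finset.univ.image c then 1 else 0) + if i ∈ Finset.univ.image c then 1 else 0 := by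
  have hne : ∀ t : Fin (m + 3), t ≠ t + 1 := fun t h => one_ne_zero (left_eq_add.1 h)
  have hsplit : ∀ t, (if i ∈ ({c t, c (t + 1)} : Finset (Fin n)) then 1 else 0) =
      (if i = c t then 1 else 0) + if i = c (t + 1) then 1 else 0 := by
    intro t
    simp only [Finset.mem_insert, Finset.mem_singleton]
    by_cases h1 : i = c t
    · have h2 : i ≠ c (t + 1) := fun h2 => hne t (hc (h1.symm.trans h2))
      simp [h1, hc.eq_iff]
    · simp [h1]
  have hsum : (∑ t, if i = c t then 1 else 0) = if i ∈ Finset.univ.image c then 1 else 0 := by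
    split_ifs with h
    · obtain ⟨t, -, rfl⟩ := Finset.mem_image.1 h
      simp [hc.eq_iff]
    · refine Finset.sum_eq_zero fun t _ => if_neg ?_
      rintro rfl
      exact h (Finset.mem_image_of_mem c (Finset.mem_univ t))
  rw [Finset.sum_congr rfl fun t _ => hsplit t, Finset.sum_add_distrib, ← hsum]
  congr 1
  exact Equiv.sum_comp (Equiv.addRight (1 : Fin (m + 3))) fun t => if i = c t then 1 else 0

/-- The colouring of the parties which gives the second and the third party of a cycle colours
of their own. -/
def cycleColouring {m : ℕ} (c : Fin (m + 3) → Fin n) (i : Fin n) : ZMod 3 :=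
  if i = c 1 then 1 else if i = c 2 then 2 else 0

theorem prod_cycle_rotationWeight_lt {m : ℕ} {c : Fin (m + 3) → Fin n}
    (hc : Function.Injective c) :
    ∏ t, rotationWeight (cycleColouring c) {c t, c (t + 1)} <
      rotationWeight (cycleColouring c) (Finset.univ.image c) *
        rotationWeight (cycleColouring c) (Finset.univ.image c) := by
  have h10 : (1 : Fin (m + 3)) ≠ 0 := one_ne_zero
  have h2 : (2 : Fin (m + 3)).val = 2 := rfl
  have h11 : (1 : Fin (m + 3)) + 1 = 2 := rfl
  have h20 : (2 : Fin (m + 3)) ≠ 0 := fun h =>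
    absurd (h2.symm.trans (congrArg Fin.val h)) (by simp)
  have h21 : (2 : Fin (m + 3)) ≠ 1 := fun h =>
    absurd (h2.symm.trans (congrArg Fin.val h)) (by simp)
  have c0 : cycleColouring c (c 0) = 0 := by
    simp [cycleColouring, hc.eq_iff, h10.symm, h20.symm]
  have c1 : cycleColouring c (c 1) = 1 := by simp [cycleColouring]
  have c2 : cycleColouring c (c 2) = 2 := by simp [cycleColouring, hc.eq_iff, h21]
  have c3 : cycleColouring c (c (2 + 1)) ≠ 2 := by
    have h32 : (2 : Fin (m + 3)) + 1 ≠ 2 := fun h => one_ne_zero (add_eq_left.1 h)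
    simp only [cycleColouring, hc.eq_iff, if_neg h32]
    split_ifs <;> decide
  have e0 : rotationWeight (cycleColouring c) {c 0, c (0 + 1)} = 1 / 4 :=
    rotationWeight_of_ne (i := c 0) (j := c 1) (by simp) (by simp) (by rw [c0, c1]; decide)
  have e1 : rotationWeight (cycleColouring c) {c 1, c (1 + 1)} = 1 / 4 :=
    rotationWeight_of_ne (i := c 1) (j := c 2) (by simp) (by simp [h11])
      (by rw [c1, c2]; decide)
  have e2 : rotationWeight (cycleColouring c) {c 2, c (2 + 1)} = 1 / 4 :=
    rotationWeight_of_ne (i := c 2) (j := c (2 + 1)) (by simp) (by simp)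
      (by rw [c2]; exact c3.symm)
  have eC : rotationWeight (cycleColouring c) (Finset.univ.image c) = 1 / 4 :=
    rotationWeight_of_ne (Finset.mem_image_of_mem c (Finset.mem_univ 0))
      (Finset.mem_image_of_mem c (Finset.mem_univ 1)) (by rw [c0, c1]; decide)
  have hrest := Finset.prod_le_one (s := Finset.univ \ {0, 1, 2})
    (fun t _ => (rotationWeight_pos (cycleColouring c) {c t, c (t + 1)}).le)
    (fun t _ => rotationWeight_le_one (cycleColouring c) {c t, c (t + 1)})
  rw [← Finset.prod_sdiff (Finset.subset_univ ({0, 1, 2} : Finset (Fin (m + 3)))),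
    Finset.prod_insert (by simp [h10.symm, h20.symm]), Finset.prod_insert (by simp [h21.symm]),
    Finset.prod_singleton, e0, e1, e2, eC]
  linarith

theorem exists_hasGHZ_charVector_eq_not_luEquivalent (N : QNetwork n) {k : ℕ} (hk : 3 ≤ k)
    (h : N.ContainsCycle k) :
    ∃ M : QNetwork n, M.HasGHZ ∧ M.charVector = N.charVector ∧ ¬ LUEquivalent N M := by
  obtain ⟨m, rfl⟩ : ∃ m, k = m + 3 := ⟨k - 3, by omega⟩
  obtain ⟨c, hc, hedge⟩ := h
  simp only [finRotate_apply] at hedge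
  choose edge hedge using hedge
  have hinj : Function.Injective edge := fun t u htu =>
    cycle_edge_injective hc (by rw [← hedge, ← hedge, htu])
  have hC : 3 ≤ (Finset.univ.image c).card := by
    rw [Finset.card_image_of_injective _ hc, Finset.card_univ, Fintype.card_fin]
    omega
  set E := Finset.univ.image edge
  refine ⟨N.replace E (Finset.univ.image c) (Nat.le_of_succ_le hC), N.hasGHZ_replace E _ hC,
    ?_, ?_⟩
  · funext i
    rw [charVector_eq_degree, charVector_eq_degree, degree, degree,
      N.sum_replace E _ _ fun p => if i ∈ p then 1 else 0, ← sum_cycle_edge_mem hc,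
      ← Finset.sum_compl_add_sum E, Finset.sum_image hinj.injOn]
    simp only [hedge]
  · intro hLU
    have hI := hLU.rotationInvariant_eq (cycleColouring c)
    rw [rotationInvariant_eq_prod, rotationInvariant_eq_prod, Complex.ofReal_inj,
      N.prod_replace E _ _ (rotationWeight (cycleColouring c)), ← Finset.prod_compl_mul_prod E,
      Finset.prod_image hinj.injOn] at hI
    simp only [hedge] at hI
    exact (mul_lt_mul_of_pos_left (prod_cycle_rotationWeight_lt hc)
      (Finset.prod_pos fun e _ => rotationWeight_pos _ _)).ne hI

/-- The triangle network of three EPR states. -/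
def triangle : QNetwork 3 where
  numSources := 3
  parties t := {t, finRotate 3 t}
  two_le_card := by decide

theorem triangle_containsCycle : triangle.ContainsCycle 3 :=
  ⟨id, Function.injective_id, fun t => ⟨t, rfl⟩⟩

end QNetwork

end

theorem theoremS6 :
    (∀ (n : ℕ) (NA : QNetwork n), NA.IsEPR → (∃ k, 3 ≤ k ∧ NA.ContainsCycle k) →
      ∃ NB : QNetwork n, NB.HasGHZ ∧ NB.charVector = NA.charVector ∧
        ¬ QNetwork.LUEquivalent NA NB) ∧
    ¬ (∀ (n : ℕ) (N M : QNetwork n), N.charVector = M.charVector → QNetwork.LUEquivalent N M) := by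
  refine ⟨fun n NA _ ⟨k, hk, h⟩ => NA.exists_hasGHZ_charVector_eq_not_luEquivalent hk h,
    fun h => ?_⟩
  obtain ⟨M, -, hM, hLU⟩ := QNetwork.triangle.exists_hasGHZ_charVector_eq_not_luEquivalent le_rfl
    QNetwork.triangle_containsCycle
  exact hLU (h 3 _ _ hM.symm)
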